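/- **Theorem (Golden Concentration).** Let $\varphi=(1+\sqrt5)/2$, let $F_1=F_2=1$, $F_m=F_{m-1}+F_{m-2}$, and for $M\ge 1$ let $\alpha_m^{(M)}=F_m/\sum_{j=1}^M F_j$ $(1\le m\le M)$ be the normalized Fibonacci weights. Let $K$ be any constant such that $\alpha_m^{(M)}\le K\varphi^{m-M}$ for all $M\ge1$ and $1\le m\le M$ (such constants exist, e.g. $K=1$). For learners $h_1,\dots,h_M:\mathcal X\to\mathbb R$ let $\widehat f_{\rm Fib}=\sum_{m=1}^M\alpha_m^{(M)}h_m$. Let $P$ be a probability distribution on $\mathcal X\times\mathcal Y$ and let $(X_1,Y_1),\dots,(X_n,Y_n)$, $n\ge1$, be an i.i.d. sample from $P$. Let $\ell:\mathcal Y\times\mathbb R\to\mathbb R$ be a measurable loss such that, on some bounded interval $[a,b]$, every $\ell(y,\cdot)$ is $1$-Lipschitz with values in $[0,1]$. Write $R(f)=\mathbb E\,\ell(Y,f(X))$ for $(X,Y)\sim P$, and $\widehat R(f)=\frac1n\sum_{i=1}^n\ell(Y_i,f(X_i))$. For a class $\mathcal H$ of functions on $\mathcal X$ let $$\widehat{\mathcal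 R}_n(\mathcal H)=\mathbb E_\varepsilon\sup_{f\in\mathcal H}\Big|\frac1n\sum_{i=1}^n\varepsilon_i f(X_i)\Big|,\qquad \mathcal R_n(\mathcal H)=\mathbb E\,\widehat{\mathcal R}_n(\mathcal H),$$ where $\varepsilon_1,\dots,\varepsilon_n$ are independent uniform signs. Let $M\ge 1$ and $\delta>0$. 1. (Given learners.) Let $h_1,\dots,h_M$ be measurable functions with $h_m(X)\in[a,b]$ almost surely, and put $R_1=\widehat{\mathcal R}_n(\{h_1\})$. Then with probability at least $1-\delta$, $$\big|R(\widehat f_{\rm Fib})-\widehat R(\widehat f_{\rm Fib})\big|\le 2\varphi K R_1+\sqrt{\frac{\log(2/\delta)}{2n}}.$$ 2. (Learners chosen from classes, possibly using the sample.) Let $\mathcal H_1,\dots,\mathcal H_M$ be pointwise measurable classes of functions $\mathcal X\to[a,b]$ (all members are measurable, and some countable subclass contains, for each member, a sequence converging pointwise to it), let $R_m=\mathcal R_n(\mathcal H_m)$, and suppose $R_1\ge R_2\ge\dots\ge R_M$. Then with probability at least $1-\delta$, the same inequality $$\big|R(\widehat f_{\rm Fib})-\widehat R(\widehat f_{\rm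 Fib})\big|\le 2\varphi K R_1+\sqrt{\frac{\log(2/\delta)}{2n}}$$ holds simultaneously for all $\widehat f_{\rm Fib}=\sum_{m=1}^M\alpha_m^{(M)}h_m$ with $h_m\in\mathcal H_m$. (For $\delta>2$ the square root is read as $0$; for $\delta\ge1$ the claim is void.) -/

import Mathlib

open MeasureTheory Filter Topology

noncomputable section

/-- The normalized Fibonacci weights `F_m / ∑_{j=1}^M F_j`; the index `m : Fin M` is zero-based,
so it stands for the `(m + 1)`-st learner. -/
def fibWeight (M : ℕ) (m : Fin M) : ℝ :=
  (Nat.fib ((m : ℕ) + 1) : ℝ) / ∑ j : Fin M, (Nat.fib ((j : ℕ) + 1) : ℝ)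

/-- The Fibonacci-weighted ensemble of `h_1, …, h_M`. -/
def fibEnsemble {X : Type*} {M : ℕ} (h : Fin M → X → ℝ) (x : X) : ℝ :=
  ∑ m : Fin M, fibWeight M m * h m x

/-- `K` is a constant, not depending on the number of learners, in the geometric bound
`α_m ≤ K φ^(m - M)` on the normalized Fibonacci weights (`φ` is the golden ratio). -/
def IsFibDecayConstant (K : ℝ) : Prop :=
  ∀ (M : ℕ) (m : Fin M),
    fibWeight M m ≤ K * Real.goldenRatio ^ (((m : ℕ) : ℤ) + 1 - (M : ℤ))

/-- Such constants exist: `K = 1` is one. -/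
theorem isFibDecayConstant_one : IsFibDecayConstant 1 := by
  have hφ := Real.goldenRatio_pos
  have hsq := Real.goldenRatio_sq
  have h1 : ∀ k : ℕ, (Nat.fib (k + 1) : ℝ) ≤ Real.goldenRatio ^ k ∧
      (Nat.fib (k + 2) : ℝ) ≤ Real.goldenRatio ^ (k + 1) := by
    intro k
    induction k with
    | zero => simpa using Real.one_lt_goldenRatio.le
    | succ k ih =>
      refine ⟨ih.2, ?_⟩
      have : Nat.fib (k + 1 + 2) = Nat.fib (k + 1) + Nat.fib (k + 2) := Nat.fib_add_two
      rw [this]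
      push_cast
      have e : Real.goldenRatio ^ (k + 1 + 1)
          = Real.goldenRatio ^ k + Real.goldenRatio ^ (k + 1) := by
        rw [show k + 1 + 1 = k + 2 from rfl, pow_add, hsq]; ring
      linarith [ih.1, ih.2]
  have h2 : ∀ M : ℕ, ∑ j : Fin M, (Nat.fib ((j : ℕ) + 1) : ℝ) = Nat.fib (M + 2) - 1 := by
    intro M
    induction M with
    | zero => simp
    | succ M ih =>
      have : Nat.fib (M + 1 + 2) = Nat.fib (M + 1) + Nat.fib (M + 2) := Nat.fib_add_two
      rw [Fin.sum_univ_castSucc]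
      simp only [Fin.val_castSucc, Fin.val_last]
      rw [ih, this]; push_cast; ring
  have h3 : ∀ k : ℕ, Real.goldenRatio ^ k ≤ (Nat.fib (k + 3) : ℝ) - 1 ∧
      Real.goldenRatio ^ (k + 1) ≤ (Nat.fib (k + 4) : ℝ) - 1 := by
    intro k
    induction k with
    | zero =>
      have := Real.goldenRatio_lt_two
      norm_num [Nat.fib]; linarith
    | succ k ih =>
      refine ⟨ih.2, ?_⟩
      have : Nat.fib (k + 1 + 4) = Nat.fib (k + 3) + Nat.fib (k + 4) := Nat.fib_add_two
      rw [this]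
      push_cast
      have e : Real.goldenRatio ^ (k + 1 + 1)
          = Real.goldenRatio ^ k + Real.goldenRatio ^ (k + 1) := by
        rw [show k + 1 + 1 = k + 2 from rfl, pow_add, hsq]; ring
      linarith [ih.1, ih.2]
  rintro M ⟨m, hm⟩
  obtain ⟨k, rfl⟩ : ∃ k, M = m + 1 + k := ⟨M - (m + 1), by omega⟩
  have hS := (h3 (m + k)).1
  have hp : 0 < Real.goldenRatio ^ (m + k) := by positivity
  rw [fibWeight, h2, one_mul]
  dsimp only
  rw [show ((m : ℤ) + 1 - ((m + 1 + k : ℕ) : ℤ)) = -(k : ℤ) by push_cast; ring,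
    zpow_neg, zpow_natCast,
    show m + 1 + k + 2 = m + k + 3 by ring, div_le_iff₀ (by linarith),
    inv_mul_eq_div, le_div_iff₀ (by positivity)]
  calc _ ≤ Real.goldenRatio ^ m * Real.goldenRatio ^ k := by
        gcongr; exact (h1 m).1
    _ = Real.goldenRatio ^ (m + k) := (pow_add _ _ _).symm
    _ ≤ _ := hS

/-- The hypothesis class of Fibonacci ensembles whose `m`-th learner is taken from `H m`. -/
def fibClass {X : Type*} {M : ℕ} (H : Fin M → Set (X → ℝ)) : Set (X → ℝ) :=
  {f | ∃ h : Fin M → X → ℝ, (∀ m, h m ∈ H m) ∧ f = fibEnsemble h}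

/-- The empirical Rademacher complexity `E_ε sup_{f ∈ H} |(1/n) ∑ ε_i f(x_i)|` of a class on the
points `x_1, …, x_n`; the expectation is the average over all `2 ^ n` sign vectors. -/
def empRademacher {X : Type*} {n : ℕ} (H : Set (X → ℝ)) (x : Fin n → X) : ℝ :=
  (∑ ε : Fin n → ℤˣ, ⨆ f : H, |(∑ i, ((ε i : ℤ) : ℝ) * (f : X → ℝ) (x i)) / (n : ℝ)|) / 2 ^ n

/-- The law of an i.i.d. sample of size `n` from `P`. -/
def sampleLaw {Z : Type*} [MeasurableSpace Z] (P : Measure Z) (n : ℕ) : Measure (Fin n → Z) :=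
  Measure.pi fun _ => P

/-- The expected Rademacher complexity: the mean of the empirical one over the inputs of an i.i.d.
sample. -/
def rademacher {X Y : Type*} [MeasurableSpace X] [MeasurableSpace Y]
    (P : Measure (X × Y)) (n : ℕ) (H : Set (X → ℝ)) : ℝ :=
  ∫ S, empRademacher H (fun i => (S i).1) ∂(sampleLaw P n)

/-- The risk `E ℓ(Y, f(X))`. -/
def risk {X Y : Type*} [MeasurableSpace X] [MeasurableSpace Y]
    (P : Measure (X × Y)) (loss : Y → ℝ → ℝ) (f : X → ℝ) : ℝ :=
  ∫ p, loss p.2 (f p.1) ∂P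

/-- The empirical risk on the sample `S`. -/
def empRisk {X Y : Type*} {n : ℕ} (loss : Y → ℝ → ℝ) (f : X → ℝ) (S : Fin n → X × Y) : ℝ :=
  (∑ i, loss (S i).2 (f (S i).1)) / (n : ℝ)

/-- A pointwise measurable class: its members are measurable, and some countable subclass
approximates every member pointwise. This makes suprema over the class measurable. -/
def PointwiseMeasurableClass {X : Type*} [MeasurableSpace X] (H : Set (X → ℝ)) : Prop :=
  (∀ f ∈ H, Measurable f) ∧
    ∃ C ⊆ H, C.Countable ∧ ∀ f ∈ H, ∃ g : ℕ → X → ℝ,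
      (∀ k, g k ∈ C) ∧ ∀ x, Tendsto (fun k => g k x) atTop (𝓝 (f x))

end

/-! The Fibonacci weights are nonnegative and sum to one, so an ensemble is a convex combination of
its learners: it stays in `[a, b]`, and its Rademacher average is at most the weighted mean of the
`R_m`, hence at most `R_1` when the `R_m` decrease. Every admissible `K` is at least `1` (take a
single learner), so `φ K ≥ 1` and the bound with constant `2 R_1` already implies the stated one.

The rest is the uniform deviation bound. The supremum of risk minus empirical risk over a countable
class changes by at most `1 / n` when one sample point changes, so McDiarmid's inequality
(`measure_ge_le_of_boundedDifferences`) controls its upper tail. Its mean is at most twice the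
Rademacher average of the losses (`integral_ciSup_sub_sampleMean_le`), and contraction
(`sum_signs_ciSup_le_of_contraction`) removes the loss. Both steps work with suprema without
absolute values, so contraction costs no factor. The other tail is the same bound for `1 - loss`;
each tail gets `δ / 2`.

For given learners the class is a single function, whose signed average has mean zero; the term in
`R_1` is then mere slack. For general classes, pointwise approximation reduces to countable
subclasses. -/

/-! ### McDiarmid's inequality. -/

/-- **McDiarmid's inequality**, moment generating function form: a function of `n` i.i.d. variables
that changes by at most `c` when one variable changes is sub-Gaussian around its mean. -/
theorem hasSubgaussianMGF_of_boundedDifferences {Z : Type*} [MeasurableSpace Z] (P : Measure Z)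
    [IsProbabilityMeasure P] (c B : ℝ) (n : ℕ) (f : (Fin n → Z) → ℝ)
    (hf : Measurable f) (hB : ∀ S, |f S| ≤ B)
    (hd : ∀ S i z, |f (Function.update S i z) - f S| ≤ c) :
    ProbabilityTheory.HasSubgaussianMGF (fun S => f S - ∫ S, f S ∂(Measure.pi fun _ => P))
      (n * (‖c‖₊ / 2) ^ 2) (Measure.pi fun _ : Fin n => P) := by
  have hexp : ∀ t : ℝ, Integrable (fun S => Real.exp (t * (f S - ∫ S, f S ∂(Measure.pi fun _ => P))))
      (Measure.pi fun _ : Fin n => P) := by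
    intro t
    refine ProbabilityTheory.integrable_exp_mul_of_mem_Icc
      (a := -B - ∫ S, f S ∂(Measure.pi fun _ => P)) (b := B - ∫ S, f S ∂(Measure.pi fun _ => P))
      (hf.sub_const _).aemeasurable (ae_of_all _ fun S => ?_)
    have := abs_le.1 (hB S)
    constructor <;> linarith
  refine ⟨hexp, ?_⟩
  intro t
  induction n with
  | zero =>
    simp only [ProbabilityTheory.mgf]
    rw [integral_unique, integral_unique]
    simp
  | succ n ih =>
    have hmp := (measurePreserving_piFinSuccAbove (fun _ : Fin (n + 1) => P) 0).symm
    have hemb := (MeasurableEquiv.piFinSuccAbove (fun _ : Fin (n + 1) => Z) 0).symm.measurableEmbedding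
    have heq : ⇑(MeasurableEquiv.piFinSuccAbove (fun _ : Fin (n + 1) => Z) 0).symm
        = fun p : Z × (Fin n → Z) => (Fin.cons p.1 p.2 : Fin (n + 1) → Z) := by
      funext p
      exact Fin.insertNth_zero' p.1 p.2
    rw [heq] at hmp hemb
    have hcons := hmp.measurable
    have hI : ∀ F : (Fin (n + 1) → Z) → ℝ, ∫ S, F S ∂(Measure.pi fun _ => P)
        = ∫ p, F (Fin.cons p.1 p.2) ∂(P.prod (Measure.pi fun _ : Fin n => P)) := fun F =>
      (hmp.integral_comp hemb F).symm
    have hfc : ∀ z, Measurable fun S : Fin n → Z => f (Fin.cons z S) := fun z =>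
      (hf.comp hcons).comp measurable_prodMk_left
    have hdc : ∀ z S i w, |f (Fin.cons z (Function.update S i w)) - f (Fin.cons z S)| ≤ c := by
      intro z S i w
      rw [Fin.cons_update]
      exact hd _ _ _
    have hint : ∀ z, Integrable (fun S : Fin n → Z => f (Fin.cons z S))
        (Measure.pi fun _ : Fin n => P) := fun z =>
      Integrable.of_bound (hfc z).aestronglyMeasurable B (ae_of_all _ fun S => hB _)
    -- Conditional mean given the first coordinate. In `f - E f = (f - g) + (g - E g)` the first
    -- term falls under the induction hypothesis with that coordinate frozen, the second under
    -- Hoeffding's lemma.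
    set g : Z → ℝ := fun z => ∫ S, f (Fin.cons z S) ∂(Measure.pi fun _ : Fin n => P) with hg
    have hgm : Measurable g :=
      StronglyMeasurable.measurable <| StronglyMeasurable.integral_prod_right
        (f := fun z S => f (Fin.cons z S)) (hf.comp hcons).stronglyMeasurable
    have hgd : ∀ z w, g w ≤ g z + c := by
      intro z w
      have : g z + c = ∫ S, (f (Fin.cons z S) + c) ∂(Measure.pi fun _ : Fin n => P) := by
        rw [integral_add (hint z) (integrable_const _)]; simp [hg]
      rw [this]
      refine integral_mono (hint w) ((hint z).add (integrable_const _)) fun S => ?_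
      have := hd (Fin.cons z S) 0 w
      rw [Fin.update_cons_zero] at this
      have := (abs_le.1 this).2
      dsimp only
      linarith
    have hEf : ∫ S, f S ∂(Measure.pi fun _ : Fin (n + 1) => P) = ∫ z, g z ∂P := by
      rw [hI, integral_prod]
      exact Integrable.of_bound (hf.comp hcons).aestronglyMeasurable B (ae_of_all _ fun S => hB _)
    obtain ⟨z₀⟩ : Nonempty Z := P.nonempty_of_neZero
    have hbdd : BddBelow (Set.range g) :=
      ⟨g z₀ - c, by rintro _ ⟨z, rfl⟩; linarith [hgd z z₀]⟩
    have : Nonempty Z := ⟨z₀⟩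
    -- Any two values of `g` differ by at most `c`, so its range lies in an interval of length `c`
    -- starting at its infimum.
    have hgsub := ProbabilityTheory.hasSubgaussianMGF_of_mem_Icc (μ := P) (a := ⨅ z, g z)
      (b := (⨅ z, g z) + c) hgm.aemeasurable (ae_of_all _ fun z => ⟨ciInf_le hbdd z, by
        rw [← sub_le_iff_le_add]
        exact le_ciInf fun w => by linarith [hgd w z]⟩)
    have hg2 := hgsub.mgf_le t
    rw [add_sub_cancel_left] at hg2
    have hih := fun z => ih (fun S => f (Fin.cons z S)) (hfc z) (fun S => hB _) (hdc z)
      (fun t => by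
        refine ProbabilityTheory.integrable_exp_mul_of_mem_Icc
          (a := -B - g z) (b := B - g z)
          ((hfc z).sub_const _).aemeasurable (ae_of_all _ fun S => ?_)
        have := abs_le.1 (hB (Fin.cons z S))
        constructor <;> linarith)
    simp only [ProbabilityTheory.mgf] at hih hg2 ⊢
    set E := ∫ S, f S ∂(Measure.pi fun _ : Fin (n + 1) => P) with hE
    have hexp' := (hmp.integrable_comp_emb hemb).2 (hexp t)
    rw [hI, integral_prod (fun p : Z × (Fin n → Z) => Real.exp (t * (f (Fin.cons p.1 p.2) - E))) hexp']
    have hexpg : Integrable (fun z => Real.exp (t * (g z - E))) P := by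
      rw [hEf]; exact hgsub.integrable_exp_mul t
    calc ∫ z, ∫ S, Real.exp (t * (f (Fin.cons z S) - E)) ∂(Measure.pi fun _ : Fin n => P) ∂P
        ≤ ∫ z, Real.exp ((n * (‖c‖₊ / 2) ^ 2 : NNReal) * t ^ 2 / 2)
            * Real.exp (t * (g z - E)) ∂P := by
          refine integral_mono hexp'.integral_prod_left (hexpg.const_mul _) fun z => ?_
          have : ∀ S : Fin n → Z, Real.exp (t * (f (Fin.cons z S) - E))
              = Real.exp (t * (f (Fin.cons z S) - g z)) * Real.exp (t * (g z - E)) := by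
            intro S; rw [← Real.exp_add]; ring_nf
          simp only [this]
          rw [integral_mul_const]
          gcongr
          exact hih z
      _ ≤ Real.exp ((n * (‖c‖₊ / 2) ^ 2 : NNReal) * t ^ 2 / 2)
            * Real.exp (((‖c‖₊ / 2) ^ 2 : NNReal) * t ^ 2 / 2) := by
          rw [integral_const_mul, hEf]
          gcongr
      _ = _ := by
          rw [← Real.exp_add]; push_cast; ring_nf

/-- **McDiarmid's inequality** for a function of `n` i.i.d. variables that changes by at most `1 / n`
when one variable changes. -/
theorem measure_ge_le_of_boundedDifferences {Z : Type*} [MeasurableSpace Z] (P : Measure Z)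
    [IsProbabilityMeasure P] (B : ℝ) {n : ℕ} (hn : 0 < n) (f : (Fin n → Z) → ℝ)
    (hf : Measurable f) (hB : ∀ S, |f S| ≤ B)
    (hd : ∀ S i z, |f (Function.update S i z) - f S| ≤ 1 / n) {t : ℝ} (ht : 0 ≤ t) :
    (sampleLaw P n).real {S | t ≤ f S - ∫ S, f S ∂(sampleLaw P n)}
      ≤ Real.exp (-(2 * n * t ^ 2)) := by
  have hn' : (0 : ℝ) < n := by exact_mod_cast hn
  refine ((hasSubgaussianMGF_of_boundedDifferences P (1 / n) B n f hf hB
    hd).measure_ge_le ht).trans_eq ?_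
  congr 1
  -- The variance proxy is `n (1 / (2n))² = 1 / (4n)`, and `t² / (2 / (4n)) = 2 n t²`.
  push_cast
  rw [Real.norm_of_nonneg (by positivity)]
  field_simp

/-! ### Contraction for Rademacher averages. -/

/-- The two-point step of the contraction principle. -/
theorem ciSup_add_ciSup_le_of_contraction {ι : Type*} [Nonempty ι] {c u v : ι → ℝ} {B : ℝ}
    (hc : ∀ k, |c k| ≤ B) (hv : ∀ k, |v k| ≤ B)
    (huv : ∀ k l, |u k - u l| ≤ |v k - v l|) :
    (⨆ k, (c k + u k)) + (⨆ k, (c k - u k)) ≤ (⨆ k, (c k + v k)) + ⨆ k, (c k - v k) := by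
  have b1 : BddAbove (Set.range fun k => c k + v k) := ⟨B + B, by
    rintro _ ⟨k, rfl⟩
    linarith [le_abs_self (c k), hc k, le_abs_self (v k), hv k]⟩
  have b2 : BddAbove (Set.range fun k => c k - v k) := ⟨B + B, by
    rintro _ ⟨k, rfl⟩
    linarith [le_abs_self (c k), hc k, neg_abs_le (v k), hv k]⟩
  rw [← le_sub_iff_add_le]
  refine ciSup_le fun k => ?_
  rw [le_sub_comm]
  refine ciSup_le fun l => ?_
  have h1 := le_ciSup b1 k
  have h2 := le_ciSup b2 l
  have h3 := le_ciSup b1 l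
  have h4 := le_ciSup b2 k
  have h5 := (le_abs_self _).trans (huv k l)
  -- The sign of `v k - v l` decides which of `k`, `l` is inserted in the supremum with `+ v` and
  -- which in the one with `- v`.
  rcases abs_cases (v k - v l) with h | h <;> linarith

/-- Sums over sign vectors, split according to the first sign. -/
theorem sum_signs_succ {n : ℕ} (F : (Fin (n + 1) → ℤˣ) → ℝ) :
    ∑ ε, F ε = ∑ ε : Fin n → ℤˣ, (F (Fin.cons 1 ε) + F (Fin.cons (-1) ε)) := by
  rw [← (Fin.consEquiv fun _ : Fin (n + 1) => ℤˣ).sum_comp, Fintype.sum_prod_type,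
    show (Finset.univ : Finset ℤˣ) = {1, -1} from rfl, Finset.sum_pair (by decide),
    ← Finset.sum_add_distrib]
  rfl

theorem abs_sign_mul (e : ℤˣ) (x : ℝ) : |((e : ℤ) : ℝ) * x| = |x| := by
  rcases Int.units_eq_one_or e with rfl | rfl <;> simp

/-- **Contraction principle** for Rademacher averages without absolute values. -/
theorem sum_signs_ciSup_le_of_contraction {ι : Type*} [Nonempty ι] {n : ℕ} (B : ℝ)
    (c : ι → ℝ) (u v : ι → Fin n → ℝ) (hc : ∃ C, ∀ k, |c k| ≤ C) (hu : ∀ k i, |u k i| ≤ B)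
    (hv : ∀ k i, |v k i| ≤ B) (huv : ∀ i k l, |u k i - u l i| ≤ |v k i - v l i|) :
    ∑ ε : Fin n → ℤˣ, ⨆ k, (c k + ∑ i, ((ε i : ℤ) : ℝ) * u k i)
      ≤ ∑ ε : Fin n → ℤˣ, ⨆ k, (c k + ∑ i, ((ε i : ℤ) : ℝ) * v k i) := by
  induction n generalizing c with
  | zero => simp
  | succ n ih =>
    obtain ⟨C, hC⟩ := hc
    -- The offset absorbs the first summand with its sign fixed, so induction replaces `u` by `v` in
    -- the other coordinates. The two-point step then treats the first coordinate.
    have key := fun e : ℤˣ => ih (fun k => c k + ((e : ℤ) : ℝ) * u k 0) (fun k i => u k i.succ)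
      (fun k i => v k i.succ) ⟨C + B, fun k => (abs_add_le _ _).trans
        (add_le_add (hC k) ((abs_sign_mul _ _).trans_le (hu k 0)))⟩ (fun k i => hu _ _)
      (fun k i => hv _ _) (fun i k l => huv _ _ _)
    have k1 := key 1
    have k2 := key (-1)
    rw [sum_signs_succ, sum_signs_succ]
    simp only [Fin.sum_univ_succ, Fin.cons_zero, Fin.cons_succ, Finset.sum_add_distrib] at k1 k2 ⊢
    simp only [← add_assoc]
    refine (add_le_add k1 k2).trans ?_
    rw [← Finset.sum_add_distrib, ← Finset.sum_add_distrib]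
    refine Finset.sum_le_sum fun ε _ => ?_
    have := ciSup_add_ciSup_le_of_contraction (c := fun k => c k + ∑ i, ((ε i : ℤ) : ℝ) * v k i.succ)
      (u := fun k => u k 0) (v := fun k => v k 0) (B := max (C + n * B) B)
      (fun k => le_max_of_le_left ((abs_add_le _ _).trans (add_le_add (hC k)
        ((Finset.abs_sum_le_sum_abs _ _).trans ((Finset.sum_le_sum fun i _ =>
          (abs_sign_mul _ _).trans_le (hv k i.succ)).trans_eq (by simp))))))
      (fun k => le_max_of_le_right (hv k 0)) (huv 0)
    simpa [add_right_comm, sub_eq_add_neg] using this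

/-! ### Bounded suprema and sample means. -/

theorem bddAbove_range_of_abs_le {ι : Type*} {F : ι → ℝ} {B : ℝ} (h : ∀ k, |F k| ≤ B) :
    BddAbove (Set.range F) :=
  ⟨B, by rintro _ ⟨l, rfl⟩; exact (abs_le.1 (h l)).2⟩

theorem abs_ciSup_le {ι : Type*} [Nonempty ι] {F : ι → ℝ} {B : ℝ} (h : ∀ k, |F k| ≤ B) :
    |⨆ k, F k| ≤ B := by
  have hb := bddAbove_range_of_abs_le h
  have k := Classical.arbitrary ι
  exact abs_le.2 ⟨(abs_le.1 (h k)).1.trans (le_ciSup hb k), ciSup_le fun l => (abs_le.1 (h l)).2⟩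

theorem abs_sum_div_le {n : ℕ} {x : Fin n → ℝ} {B : ℝ} (hB : 0 ≤ B) (h : ∀ i, |x i| ≤ B) :
    |(∑ i, x i) / (n : ℝ)| ≤ B := by
  rw [abs_div, Nat.abs_cast]
  refine div_le_of_le_mul₀ (by positivity) hB ((Finset.abs_sum_le_sum_abs _ _).trans
    ((Finset.sum_le_sum fun i _ => h i).trans_eq ?_))
  simp [mul_comm]

theorem integrable_ciSup_of_abs_le {Ω ι : Type*} [MeasurableSpace Ω] [Countable ι] [Nonempty ι]
    {μ : Measure Ω} [IsFiniteMeasure μ] {F : ι → Ω → ℝ} {B : ℝ} (hF : ∀ k, Measurable (F k))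
    (hB : ∀ k ω, |F k ω| ≤ B) : Integrable (fun ω => ⨆ k, F k ω) μ :=
  Integrable.of_bound (Measurable.iSup hF).aestronglyMeasurable B
    (ae_of_all _ fun ω => abs_ciSup_le fun k => hB k ω)

/-- The mean of the average over an i.i.d. sample. -/
theorem integral_sampleMean {Z : Type*} [MeasurableSpace Z] (P : Measure Z)
    [IsProbabilityMeasure P] {n : ℕ} (hn : 0 < n) {g : Z → ℝ} (hg : Integrable g P) :
    ∫ S, (∑ i, g (S i)) / (n : ℝ) ∂(sampleLaw P n) = ∫ z, g z ∂P := by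
  have hn' : (n : ℝ) ≠ 0 := by exact_mod_cast hn.ne'
  have hmp := fun i : Fin n => measurePreserving_eval (fun _ : Fin n => P) i
  rw [integral_div, sampleLaw, integral_finsetSum]
  · have : ∀ i : Fin n, ∫ S, g (S i) ∂(Measure.pi fun _ : Fin n => P) = ∫ z, g z ∂P := fun i =>
      integral_comp_eval (μ := fun _ : Fin n => P) (i := i) hg.aestronglyMeasurable
    simp only [this, Finset.sum_const, Finset.card_univ, Fintype.card_fin, nsmul_eq_mul]
    field_simp
  · intro i _
    exact (hmp i).integrable_comp_of_integrable hg

instance sampleLaw.instIsProbabilityMeasure {Z : Type*} [MeasurableSpace Z] (P : Measure Z)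
    [IsProbabilityMeasure P] (n : ℕ) : IsProbabilityMeasure (sampleLaw P n) := by
  unfold sampleLaw; infer_instance

/-! ### Symmetrization. -/

/-- Swapping the two entries of the pairs with sign `-1`. -/
def signSwap {Z : Type*} {n : ℕ} (ε : Fin n → ℤˣ) (W : Fin n → Z × Z) (i : Fin n) : Z × Z :=
  if ε i = 1 then W i else (W i).swap

/-- The two entries of each pair are exchangeable, and the pairs are independent. This is what
allows signs to be inserted. -/
theorem measurePreserving_signSwap {Z : Type*} [MeasurableSpace Z] (P : Measure Z)
    [IsProbabilityMeasure P] {n : ℕ} (ε : Fin n → ℤˣ) :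
    MeasurePreserving (signSwap ε) (sampleLaw (P.prod P) n) (sampleLaw (P.prod P) n) := by
  refine measurePreserving_pi (fun _ : Fin n => P.prod P) (fun _ : Fin n => P.prod P)
    (f := fun i w => if ε i = 1 then w else w.swap) fun i => ?_
  split_ifs
  · exact MeasurePreserving.id _
  · exact Measure.measurePreserving_swap

/-- **Symmetrization**, one-sided, for a countable family of bounded functions. -/
theorem integral_ciSup_sub_sampleMean_le {Z ι : Type*} [MeasurableSpace Z] (P : Measure Z)
    [IsProbabilityMeasure P] [Countable ι] [Nonempty ι] {n : ℕ} (hn : 0 < n) {B : ℝ} (hB : 0 ≤ B)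
    (g : ι → Z → ℝ) (hg : ∀ k, Measurable (g k)) (hgB : ∀ k z, |g k z| ≤ B) :
    ∫ S, (⨆ k, (∫ z, g k z ∂P - (∑ i, g k (S i)) / (n : ℝ))) ∂(sampleLaw P n)
      ≤ 2 * ∫ S, (∑ ε : Fin n → ℤˣ, ⨆ k, (∑ i, ((ε i : ℤ) : ℝ) * g k (S i)) / (n : ℝ)) / 2 ^ n
        ∂(sampleLaw P n) := by
  have hgi : ∀ k, Integrable (g k) P := fun k =>
    Integrable.of_bound (hg k).aestronglyMeasurable B (ae_of_all _ (hgB k))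
  have hgd : ∀ k z w, |g k z - g k w| ≤ B + B := fun k z w =>
    (abs_sub _ _).trans (add_le_add (hgB k z) (hgB k w))
  have hI : ∀ k, |∫ z, g k z ∂P| ≤ B := fun k => by
    simpa using norm_integral_le_of_norm_le_const (μ := P) (f := g k) (C := B) (ae_of_all _ (hgB k))
  -- the Rademacher average for a fixed sign vector
  set A : (Fin n → ℤˣ) → (Fin n → Z) → ℝ := fun ε S =>
    ⨆ k, (∑ i, ((ε i : ℤ) : ℝ) * g k (S i)) / (n : ℝ) with hA
  have hAb : ∀ (ε : Fin n → ℤˣ) (S : Fin n → Z) k, |(∑ i, ((ε i : ℤ) : ℝ) * g k (S i)) / (n : ℝ)| ≤ B := fun ε S k =>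
    abs_sum_div_le hB fun i => (abs_sign_mul _ _).trans_le (hgB _ _)
  have hAi : ∀ ε, Integrable (A ε) (sampleLaw P n) := fun ε =>
    integrable_ciSup_of_abs_le (B := B) (fun k => by fun_prop) fun k S => hAb ε S k
  -- the symmetrized deviation for a fixed sign vector
  set D : (Fin n → ℤˣ) → (Fin n → Z × Z) → ℝ := fun ε W =>
    ⨆ k, (∑ i, ((ε i : ℤ) : ℝ) * (g k (W i).2 - g k (W i).1)) / (n : ℝ) with hD
  have hDb : ∀ (ε : Fin n → ℤˣ) (W : Fin n → Z × Z) k, |(∑ i, ((ε i : ℤ) : ℝ) * (g k (W i).2 - g k (W i).1)) / (n : ℝ)| ≤ B + B :=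
    fun ε W k => abs_sum_div_le (by linarith) fun i => (abs_sign_mul _ _).trans_le (hgd _ _ _)
  have hDi : ∀ ε, Integrable (D ε) (sampleLaw (P.prod P) n) := fun ε =>
    integrable_ciSup_of_abs_le (B := B + B) (fun k => by fun_prop) fun k S => hDb ε S k
  have hDm : ∀ ε, Measurable (D ε) := fun ε => Measurable.iSup fun k => by fun_prop
  -- Ghost sample: the second entries of the pairs form an independent sample whose mean represents
  -- the risk. The supremum of an integral is at most the integral of the supremum; the sign vector
  -- `1` is all plus.
  have step1 : ∫ S, (⨆ k, (∫ z, g k z ∂P - (∑ i, g k (S i)) / (n : ℝ))) ∂(sampleLaw P n)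
      ≤ ∫ W, D 1 W ∂(sampleLaw (P.prod P) n) := by
    have hmp := (measurePreserving_arrowProdEquivProdArrow Z Z (Fin n) (fun _ => P)
      (fun _ => P)).symm
    have e1 := hmp.integral_comp' (g := D 1)
    have i1 := (hmp.integrable_comp_emb (MeasurableEquiv.measurableEmbedding _)).2 (hDi 1)
    rw [sampleLaw, sampleLaw, ← e1]
    rw [integral_prod (fun p : (Fin n → Z) × (Fin n → Z) =>
      D 1 ((MeasurableEquiv.arrowProdEquivProdArrow Z Z (Fin n)).symm p)) i1]
    refine integral_mono (integrable_ciSup_of_abs_le (B := B + B) (fun k => by fun_prop) fun k S =>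
      (abs_sub _ _).trans (add_le_add (hI k) (abs_sum_div_le hB fun i => hgB _ _)))
      i1.integral_prod_left fun S => ciSup_le fun k => ?_
    rw [← integral_sampleMean P hn (hgi k)]
    have hmi : Integrable (fun S : Fin n → Z => (∑ i, g k (S i)) / (n : ℝ)) (sampleLaw P n) :=
      Integrable.of_bound (Measurable.aestronglyMeasurable (by fun_prop)) B
        (ae_of_all _ fun S => abs_sum_div_le hB fun i => hgB _ _)
    have : ∫ S', (∑ i, g k (S' i)) / (n : ℝ) ∂(sampleLaw P n) - (∑ i, g k (S i)) / (n : ℝ)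
        = ∫ S', ((∑ i, g k (S' i)) / (n : ℝ) - (∑ i, g k (S i)) / (n : ℝ)) ∂(sampleLaw P n) := by
      rw [integral_sub hmi (integrable_const _)]; simp
    rw [this]
    refine integral_mono (hmi.sub (integrable_const _)) ?_ fun S' => ?_
    · refine Integrable.of_bound (((hDm 1).comp (MeasurableEquiv.measurable _)).comp
        measurable_prodMk_left).aestronglyMeasurable (B + B)
        (ae_of_all _ fun S' => abs_ciSup_le fun k => hDb 1 _ k)
    · refine le_trans (le_of_eq ?_) (le_ciSup (bddAbove_range_of_abs_le fun k => hDb 1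
        ((MeasurableEquiv.arrowProdEquivProdArrow Z Z (Fin n)).symm (S, S')) k) k)
      simp [MeasurableEquiv.arrowProdEquivProdArrow, Equiv.arrowProdEquivProdArrow,
        Finset.sum_sub_distrib, sub_div]
  have step2 : ∀ ε, ∫ W, D 1 W ∂(sampleLaw (P.prod P) n) = ∫ W, D ε W ∂(sampleLaw (P.prod P) n) := by
    intro ε
    have hmp := measurePreserving_signSwap P ε
    rw [← hmp.map_eq, integral_map hmp.measurable.aemeasurable (hDm 1).aestronglyMeasurable,
      hmp.map_eq]
    congr 1 with W
    simp only [hD]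
    congr 1 with k
    congr 2 with i
    rcases Int.units_eq_one_or (ε i) with h | h <;> simp [signSwap, h]
  have hfst : MeasurePreserving (fun (W : Fin n → Z × Z) i => (W i).1) (sampleLaw (P.prod P) n)
      (sampleLaw P n) := measurePreserving_pi _ _ fun _ => measurePreserving_fst
  have hsnd : MeasurePreserving (fun (W : Fin n → Z × Z) i => (W i).2) (sampleLaw (P.prod P) n)
      (sampleLaw P n) := measurePreserving_pi _ _ fun _ => measurePreserving_snd
  -- Subadditivity of the supremum separates the two samples; the minus sign is carried by `-ε`
  -- instead of an absolute value.
  have step3 : ∀ ε, ∫ W, D ε W ∂(sampleLaw (P.prod P) n)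
      ≤ ∫ S, A ε S ∂(sampleLaw P n) + ∫ S, A (-ε) S ∂(sampleLaw P n) := by
    intro ε
    have c1 : ∫ W, A ε (fun i => (W i).2) ∂(sampleLaw (P.prod P) n) = ∫ S, A ε S ∂(sampleLaw P n) := by
      rw [← hsnd.map_eq, integral_map hsnd.measurable.aemeasurable]
      rw [hsnd.map_eq]; exact (hAi ε).aestronglyMeasurable
    have c2 : ∫ W, A (-ε) (fun i => (W i).1) ∂(sampleLaw (P.prod P) n)
        = ∫ S, A (-ε) S ∂(sampleLaw P n) := by
      rw [← hfst.map_eq, integral_map hfst.measurable.aemeasurable]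
      rw [hfst.map_eq]; exact (hAi _).aestronglyMeasurable
    have d1 : Integrable (fun W => A ε (fun i => (W i).2)) (sampleLaw (P.prod P) n) :=
      hsnd.integrable_comp_of_integrable (hAi ε)
    have d2 : Integrable (fun W => A (-ε) (fun i => (W i).1)) (sampleLaw (P.prod P) n) :=
      hfst.integrable_comp_of_integrable (hAi (-ε))
    rw [← c1, ← c2, ← integral_add d1 d2]
    refine integral_mono (hDi ε) (d1.add d2) fun W => ciSup_le fun k => ?_
    refine le_trans (le_of_eq ?_) (add_le_add
      (le_ciSup (bddAbove_range_of_abs_le fun k => hAb ε (fun i => (W i).2) k) k)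
      (le_ciSup (bddAbove_range_of_abs_le fun k => hAb (-ε) (fun i => (W i).1) k) k))
    rw [← add_div, ← Finset.sum_add_distrib]
    congr 2 with i
    simp; ring
  refine step1.trans ?_
  rw [integral_div, integral_finsetSum _ fun ε _ => hAi ε]
  have hcard : (∑ _ε : Fin n → ℤˣ, (1 : ℝ)) = 2 ^ n := by simp
  have hsum := Finset.sum_le_sum fun ε (_ : ε ∈ (Finset.univ : Finset (Fin n → ℤˣ))) =>
    (step2 ε).trans_le (step3 ε)
  -- Negation permutes the sign vectors, so both halves have the same sum: hence the factor `2`.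
  rw [Finset.sum_add_distrib, show ∑ ε, ∫ S, A (-ε) S ∂(sampleLaw P n)
    = ∑ ε, ∫ S, A ε S ∂(sampleLaw P n) from Equiv.sum_comp (Equiv.neg (Fin n → ℤˣ))
    (fun ε => ∫ S, A ε S ∂(sampleLaw P n))] at hsum
  simp only [Finset.sum_const, Finset.card_univ, nsmul_eq_mul] at hsum hcard
  rw [mul_one] at hcard
  rw [hcard] at hsum
  rw [← mul_div_assoc, le_div_iff₀ (by positivity)]
  linarith

/-! ### Uniform deviation for countable classes. -/

theorem abs_ciSup_sub_ciSup_le {ι : Type*} [Nonempty ι] {F G : ι → ℝ} {c : ℝ}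
    (hF : BddAbove (Set.range F)) (hG : BddAbove (Set.range G)) (h : ∀ k, |F k - G k| ≤ c) :
    |(⨆ k, F k) - ⨆ k, G k| ≤ c := by
  rw [abs_sub_le_iff, sub_le_iff_le_add', sub_le_iff_le_add']
  constructor <;> refine ciSup_le fun k => ?_
  · linarith [(abs_sub_le_iff.1 (h k)).1, le_ciSup hG k]
  · linarith [(abs_sub_le_iff.1 (h k)).2, le_ciSup hF k]

/-- One-sided uniform deviation bound for a countable class, in terms of the Rademacher average
without absolute values. -/
theorem measure_risk_sub_empRisk_le {X Y ι : Type*} [MeasurableSpace X] [MeasurableSpace Y]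
    (P : Measure (X × Y)) [IsProbabilityMeasure P] [Countable ι] [Nonempty ι]
    {n : ℕ} (hn : 0 < n) {a b : ℝ} (loss : Y → ℝ → ℝ) (hmeas : Measurable (Function.uncurry loss))
    (hlip : ∀ y, LipschitzOnWith 1 (loss y) (Set.Icc a b))
    (hbdd : ∀ y, ∀ z ∈ Set.Icc a b, loss y z ∈ Set.Icc (0 : ℝ) 1)
    (f : ι → X → ℝ) (hf : ∀ k, Measurable (f k)) (hfab : ∀ k x, f k x ∈ Set.Icc a b) {r t : ℝ}
    (hr : ∫ S, (∑ ε : Fin n → ℤˣ, ⨆ k, (∑ i, ((ε i : ℤ) : ℝ) * f k (S i).1) / (n : ℝ)) / 2 ^ n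
      ∂(sampleLaw P n) ≤ r) (ht : 0 ≤ t) :
    (sampleLaw P n).real {S | ∃ k, 2 * r + t < risk P loss (f k) - empRisk loss (f k) S}
      ≤ Real.exp (-(2 * n * t ^ 2)) := by
  have hn' : (0 : ℝ) < n := by exact_mod_cast hn
  set C := max |a| |b| with hC
  have hfC : ∀ k x, |f k x| ≤ C := fun k x => abs_le_max_abs_abs (hfab k x).1 (hfab k x).2
  have hC0 : 0 ≤ C := le_max_of_le_left (abs_nonneg _)
  set g : ι → X × Y → ℝ := fun k p => loss p.2 (f k p.1) with hg
  have hgm : ∀ k, Measurable (g k) := fun k =>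
    hmeas.comp (measurable_snd.prodMk ((hf k).comp measurable_fst))
  have hg01 : ∀ k p, g k p ∈ Set.Icc (0 : ℝ) 1 := fun k p => hbdd _ _ (hfab _ _)
  have hg1 : ∀ k p, |g k p| ≤ 1 := fun k p => abs_le.2 ⟨by linarith [(hg01 k p).1], (hg01 k p).2⟩
  have hI : ∀ k, |∫ z, g k z ∂P| ≤ 1 := fun k => by
    simpa using norm_integral_le_of_norm_le_const (μ := P) (f := g k) (C := 1)
      (ae_of_all _ (hg1 k))
  have hb : ∀ (S : Fin n → X × Y) k, |∫ z, g k z ∂P - (∑ i, g k (S i)) / (n : ℝ)| ≤ 1 + 1 :=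
    fun S k => (abs_sub _ _).trans
      (add_le_add (hI k) (abs_sum_div_le zero_le_one fun i => hg1 k _))
  set Φ : (Fin n → X × Y) → ℝ := fun S => ⨆ k, (∫ z, g k z ∂P - (∑ i, g k (S i)) / (n : ℝ)) with hΦ
  have hΦm : Measurable Φ := Measurable.iSup fun k => by fun_prop
  have hdiff : ∀ S i z, |Φ (Function.update S i z) - Φ S| ≤ 1 / n := by
    intro S i z
    refine abs_ciSup_sub_ciSup_le (bddAbove_range_of_abs_le (hb _)) (bddAbove_range_of_abs_le (hb _))
      fun k => ?_
    rw [sub_sub_sub_cancel_left, ← sub_div, ← Finset.sum_sub_distrib, abs_div, Nat.abs_cast]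
    gcongr
    rw [Finset.sum_eq_single i (fun j _ hj => by simp [hj]) (by simp), Function.update_self]
    exact abs_sub_le_iff.2 ⟨by linarith [(hg01 k (S i)).2, (hg01 k z).1],
      by linarith [(hg01 k (S i)).1, (hg01 k z).2]⟩
  have hmean : ∫ S, Φ S ∂(sampleLaw P n) ≤ 2 * r := by
    refine (integral_ciSup_sub_sampleMean_le P hn zero_le_one g hgm hg1).trans ?_
    refine mul_le_mul_of_nonneg_left (le_trans (integral_mono ?_ ?_ fun S => ?_) hr) zero_le_two
    · refine (integrable_finsetSum _ fun ε _ => ?_).div_const _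
      exact integrable_ciSup_of_abs_le (B := 1) (fun k => by fun_prop) fun k S =>
        abs_sum_div_le zero_le_one fun i => (abs_sign_mul _ _).trans_le (hg1 _ _)
    · refine (integrable_finsetSum _ fun ε _ => ?_).div_const _
      exact integrable_ciSup_of_abs_le (B := C) (fun k => by fun_prop) fun k S =>
        abs_sum_div_le hC0 fun i => (abs_sign_mul _ _).trans_le (hfC _ _)
    · refine div_le_div_of_nonneg_right ?_ (by positivity)
      have h1 : ∀ x : ℝ, |x / n| ≤ |x| := fun x => by
        rw [abs_div, Nat.abs_cast]
        exact div_le_self (abs_nonneg _) (by exact_mod_cast hn)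
      -- Contraction with offset `0`, the factor `1 / n` being moved into each summand; the
      -- Lipschitz bound of the loss compares increments at the same sample point.
      have := sum_signs_ciSup_le_of_contraction (max 1 C) (fun _ : ι => (0 : ℝ))
        (fun k i => g k (S i) / n) (fun k i => f k (S i).1 / n) ⟨0, by simp⟩
        (fun k i => le_max_of_le_left ((h1 _).trans (hg1 _ _)))
        (fun k i => le_max_of_le_right ((h1 _).trans (hfC _ _))) (fun i k l => by
          rw [← sub_div, ← sub_div, abs_div, abs_div]
          refine div_le_div_of_nonneg_right ?_ (abs_nonneg _)
          simpa [hg, Real.dist_eq] using (hlip (S i).2).dist_le_mul _ (hfab k (S i).1) _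
            (hfab l (S i).1))
      simpa only [zero_add, Finset.sum_div, mul_div_assoc] using this
  refine le_trans (measureReal_mono ?_) (measure_ge_le_of_boundedDifferences P 2 hn Φ hΦm
    (fun S => abs_ciSup_le fun k => (hb S k).trans_eq (by norm_num)) hdiff ht)
  rintro S ⟨k, hk⟩
  have := le_ciSup (bddAbove_range_of_abs_le (hb S)) k
  simp only [Set.mem_ofPred_eq, risk, empRisk] at hk ⊢
  linarith

/-- Two-sided uniform deviation bound for a countable class. -/
theorem measure_abs_risk_sub_empRisk_le {X Y ι : Type*} [MeasurableSpace X] [MeasurableSpace Y]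
    (P : Measure (X × Y)) [IsProbabilityMeasure P] [Countable ι] [Nonempty ι]
    {n : ℕ} (hn : 0 < n) {a b : ℝ} (loss : Y → ℝ → ℝ) (hmeas : Measurable (Function.uncurry loss))
    (hlip : ∀ y, LipschitzOnWith 1 (loss y) (Set.Icc a b))
    (hbdd : ∀ y, ∀ z ∈ Set.Icc a b, loss y z ∈ Set.Icc (0 : ℝ) 1)
    (f : ι → X → ℝ) (hf : ∀ k, Measurable (f k)) (hfab : ∀ k x, f k x ∈ Set.Icc a b) {r δ : ℝ}
    (hr : ∫ S, (∑ ε : Fin n → ℤˣ, ⨆ k, (∑ i, ((ε i : ℤ) : ℝ) * f k (S i).1) / (n : ℝ)) / 2 ^ n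
      ∂(sampleLaw P n) ≤ r) (hδ : 0 < δ) :
    sampleLaw P n {S | ∃ k, 2 * r + √(Real.log (2 / δ) / (2 * (n : ℝ)))
      < |risk P loss (f k) - empRisk loss (f k) S|} ≤ ENNReal.ofReal δ := by
  have hn' : (0 : ℝ) < n := by exact_mod_cast hn
  rcases le_or_gt 1 δ with h1 | h1
  · exact prob_le_one.trans (by simpa using h1)
  set t := √(Real.log (2 / δ) / (2 * (n : ℝ))) with ht
  have hexp : Real.exp (-(2 * n * t ^ 2)) = δ / 2 := by
    have h2 : 1 ≤ 2 / δ := by rw [le_div_iff₀ hδ]; linarith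
    have : 2 * n * t ^ 2 = Real.log (2 / δ) := by
      rw [ht, Real.sq_sqrt (div_nonneg (Real.log_nonneg h2) (by positivity))]
      field_simp
    rw [this, Real.exp_neg, Real.exp_log (by positivity), inv_div]
  have ht0 : 0 ≤ t := Real.sqrt_nonneg _
  have p1 := measure_risk_sub_empRisk_le P hn loss hmeas hlip hbdd f hf hfab hr ht0
  -- Replacing the loss by `1 - loss` keeps the hypotheses and reverses the sign of the deviation.
  have p2 := measure_risk_sub_empRisk_le P hn (fun y z => 1 - loss y z) (hmeas.const_sub 1)
    (fun y => LipschitzOnWith.of_dist_le_mul fun u hu v hv => by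
      simpa only [dist_sub_left] using (hlip y).dist_le_mul u hu v hv)
    (fun y z hz => ⟨by linarith [(hbdd y z hz).2], by linarith [(hbdd y z hz).1]⟩)
    f hf hfab hr ht0
  rw [hexp] at p1 p2
  rw [← ofReal_measureReal]
  refine ENNReal.ofReal_le_ofReal ?_
  refine le_trans (measureReal_mono ?_) ((measureReal_union_le _ _).trans
    ((add_le_add p1 p2).trans_eq (add_halves δ)))
  rintro S ⟨k, hk⟩
  rcases lt_abs.1 hk with h | h
  · exact Or.inl ⟨k, h⟩
  · refine Or.inr ⟨k, h.trans_eq ?_⟩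
    have hint : Integrable (fun p : X × Y => loss p.2 (f k p.1)) P := by
      refine Integrable.of_bound (hmeas.comp (measurable_snd.prodMk
        ((hf k).comp measurable_fst))).aestronglyMeasurable 1 (ae_of_all _ fun p => ?_)
      have := hbdd p.2 _ (hfab k p.1)
      exact abs_le.2 ⟨by linarith [this.1], this.2⟩
    simp only [risk, empRisk]
    rw [integral_sub (integrable_const _) hint, Finset.sum_sub_distrib]
    simp only [integral_const, probReal_univ, smul_eq_mul, mul_one, Finset.sum_const,
      Finset.card_univ, Fintype.card_fin, nsmul_eq_mul, sub_div, div_self hn'.ne']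
    ring

/-! ### Fibonacci weights and the complexity of ensembles. -/

theorem sum_fib_pos {M : ℕ} (hM : 0 < M) : 0 < ∑ j : Fin M, (Nat.fib ((j : ℕ) + 1) : ℝ) :=
  have : Nonempty (Fin M) := ⟨⟨0, hM⟩⟩
  Finset.sum_pos (fun j _ => by exact_mod_cast Nat.fib_pos.2 j.1.succ_pos) Finset.univ_nonempty

theorem fibWeight_nonneg (M : ℕ) (m : Fin M) : 0 ≤ fibWeight M m := by
  unfold fibWeight; positivity

theorem sum_fibWeight {M : ℕ} (hM : 0 < M) : ∑ m, fibWeight M m = 1 := by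
  simp only [fibWeight]
  rw [← Finset.sum_div, div_self (sum_fib_pos hM).ne']

/-- A single learner has weight `1`, and the exponent of `φ` is then `0`. -/
theorem IsFibDecayConstant.one_le {K : ℝ} (hK : IsFibDecayConstant K) : 1 ≤ K := by
  simpa [fibWeight] using hK 1 0

theorem fibEnsemble_mem_Icc {X : Type*} {M : ℕ} (hM : 0 < M) {a b : ℝ} {h : Fin M → X → ℝ} {x : X}
    (hx : ∀ m, h m x ∈ Set.Icc a b) : fibEnsemble h x ∈ Set.Icc a b :=
  (convex_Icc a b).sum_mem (fun m _ => fibWeight_nonneg M m) (sum_fibWeight hM) fun m _ => hx m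

theorem measurable_fibEnsemble {X : Type*} [MeasurableSpace X] {M : ℕ} {h : Fin M → X → ℝ}
    (hh : ∀ m, Measurable (h m)) : Measurable (fibEnsemble h) := by
  unfold fibEnsemble; fun_prop

theorem empRademacher_nonneg {X : Type*} {n : ℕ} (H : Set (X → ℝ)) (x : Fin n → X) :
    0 ≤ empRademacher H x :=
  div_nonneg (Finset.sum_nonneg fun _ _ => Real.iSup_nonneg fun _ => abs_nonneg _) (by positivity)

theorem rademacher_nonneg {X Y : Type*} [MeasurableSpace X] [MeasurableSpace Y]
    (P : Measure (X × Y)) (n : ℕ) (H : Set (X → ℝ)) : 0 ≤ rademacher P n H :=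
  integral_nonneg fun _ => empRademacher_nonneg _ _

theorem abs_signSum_div_le {X : Type*} {n : ℕ} {a b : ℝ} {f : X → ℝ}
    (hf : ∀ x, f x ∈ Set.Icc a b) (ε : Fin n → ℤˣ) (x : Fin n → X) :
    |(∑ i, ((ε i : ℤ) : ℝ) * f (x i)) / (n : ℝ)| ≤ max |a| |b| :=
  abs_sum_div_le (le_max_of_le_left (abs_nonneg _)) fun _ =>
    (abs_sign_mul _ _).trans_le (abs_le_max_abs_abs (hf _).1 (hf _).2)

/-- The empirical Rademacher complexity of a pointwise measurable class of uniformly bounded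
functions is an integrable function of the sample. -/
theorem integrable_empRademacher {X Y : Type*} [MeasurableSpace X] [MeasurableSpace Y]
    (P : Measure (X × Y)) [IsProbabilityMeasure P] (n : ℕ) {a b : ℝ} {H : Set (X → ℝ)}
    (hH : PointwiseMeasurableClass H) (hne : H.Nonempty) (hab : ∀ f ∈ H, ∀ x, f x ∈ Set.Icc a b) :
    Integrable (fun S => empRademacher H (fun i => (S i).1)) (sampleLaw P n) := by
  obtain ⟨hm, C, hCH, hC, hap⟩ := hH
  obtain ⟨f₀, hf₀⟩ := hne
  obtain ⟨g₀, hg₀, -⟩ := hap f₀ hf₀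
  have : Nonempty H := ⟨⟨f₀, hf₀⟩⟩
  have : Nonempty C := ⟨⟨g₀ 0, hg₀ 0⟩⟩
  have : Countable C := hC
  have hb : ∀ (ε : Fin n → ℤˣ) (x : Fin n → X) (f : X → ℝ), f ∈ H →
      |(|(∑ i, ((ε i : ℤ) : ℝ) * f (x i)) / (n : ℝ)|)| ≤ max |a| |b| := fun ε x f hf => by
    rw [abs_abs]; exact abs_signSum_div_le (hab f hf) ε x
  -- The signed average depends on finitely many values of `f`, so it passes to pointwise limits and
  -- the supremum over `C` suffices for measurability.
  have heq : ∀ (ε : Fin n → ℤˣ) (x : Fin n → X),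
      (⨆ f : H, |(∑ i, ((ε i : ℤ) : ℝ) * (f : X → ℝ) (x i)) / (n : ℝ)|)
        = ⨆ f : C, |(∑ i, ((ε i : ℤ) : ℝ) * (f : X → ℝ) (x i)) / (n : ℝ)| := by
    intro ε x
    refine le_antisymm (ciSup_le fun f => ?_) (ciSup_le fun f => le_ciSup
      (f := fun f : H => |(∑ i, ((ε i : ℤ) : ℝ) * (f : X → ℝ) (x i)) / (n : ℝ)|)
      (bddAbove_range_of_abs_le fun f : H => hb ε x f f.2) ⟨f, hCH f.2⟩)
    obtain ⟨g, hg, hlim⟩ := hap f f.2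
    refine le_of_tendsto (((tendsto_finsetSum _ fun i _ =>
      (hlim (x i)).const_mul _).div_const _).abs) (Eventually.of_forall fun k => ?_)
    exact le_ciSup (f := fun f : C => |(∑ i, ((ε i : ℤ) : ℝ) * (f : X → ℝ) (x i)) / (n : ℝ)|)
      (bddAbove_range_of_abs_le fun f : C => hb ε x f (hCH f.2)) ⟨g k, hg k⟩
  simp only [empRademacher, heq]
  refine (integrable_finsetSum _ fun ε _ => ?_).div_const _
  refine integrable_ciSup_of_abs_le (B := max |a| |b|) (fun f => ?_) fun f S => hb ε _ f (hCH f.2)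
  have := hm f (hCH f.2)
  fun_prop

/-- The Rademacher average of Fibonacci ensembles is at most the weighted mean of the empirical
Rademacher complexities of the classes of the learners. -/
theorem signAverage_fibEnsemble_le {X ι : Type*} [Nonempty ι] {n M : ℕ} {a b : ℝ}
    {H : Fin M → Set (X → ℝ)} (hab : ∀ m, ∀ f ∈ H m, ∀ x, f x ∈ Set.Icc a b)
    (h : ι → Fin M → X → ℝ) (hh : ∀ k m, h k m ∈ H m) (x : Fin n → X) :
    (∑ ε : Fin n → ℤˣ, ⨆ k, (∑ i, ((ε i : ℤ) : ℝ) * fibEnsemble (h k) (x i)) / (n : ℝ)) / 2 ^ n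
      ≤ ∑ m, fibWeight M m * empRademacher (H m) x := by
  simp only [empRademacher, ← mul_div_assoc]
  rw [← Finset.sum_div]
  refine div_le_div_of_nonneg_right ?_ (by positivity)
  simp only [Finset.mul_sum]
  rw [Finset.sum_comm]
  refine Finset.sum_le_sum fun ε _ => ciSup_le fun k => ?_
  have e : (∑ i, ((ε i : ℤ) : ℝ) * fibEnsemble (h k) (x i)) / (n : ℝ)
      = ∑ m, fibWeight M m * ((∑ i, ((ε i : ℤ) : ℝ) * h k m (x i)) / (n : ℝ)) := by
    simp only [fibEnsemble, Finset.mul_sum, Finset.sum_div]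
    rw [Finset.sum_comm]
    refine Finset.sum_congr rfl fun m _ => Finset.sum_congr rfl fun i _ => ?_
    ring
  rw [e]
  refine Finset.sum_le_sum fun m _ => mul_le_mul_of_nonneg_left ((le_abs_self _).trans ?_)
    (fibWeight_nonneg M m)
  exact le_ciSup (f := fun f : H m => |(∑ i, ((ε i : ℤ) : ℝ) * (f : X → ℝ) (x i)) / (n : ℝ)|)
    (bddAbove_range_of_abs_le fun f : H m => by
      rw [abs_abs]; exact abs_signSum_div_le (hab m f f.2) ε x) ⟨h k m, hh k m⟩

/-- Opposite sign vectors cancel. Hence a single fixed predictor contributes no complexity term. -/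
theorem sum_signs_mul_eq_zero {n : ℕ} (x : Fin n → ℝ) :
    ∑ ε : Fin n → ℤˣ, (∑ i, ((ε i : ℤ) : ℝ) * x i) / (n : ℝ) = 0 := by
  have := Equiv.sum_comp (Equiv.neg (Fin n → ℤˣ))
    (fun ε => (∑ i, ((ε i : ℤ) : ℝ) * x i) / (n : ℝ))
  simp only [Equiv.neg_apply, Pi.neg_apply, Units.val_neg, Int.cast_neg, neg_mul,
    Finset.sum_neg_distrib, neg_div] at this
  linarith

/-! ### Concentration of Fibonacci ensembles. -/

/-- The deviation of the empirical risk along a pointwise convergent sequence of predictors. -/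
theorem tendsto_abs_risk_sub_empRisk {X Y : Type*} [MeasurableSpace X] [MeasurableSpace Y]
    (P : Measure (X × Y)) [IsProbabilityMeasure P] {n : ℕ} {a b : ℝ} {loss : Y → ℝ → ℝ}
    (hmeas : Measurable (Function.uncurry loss))
    (hlip : ∀ y, LipschitzOnWith 1 (loss y) (Set.Icc a b))
    (hbdd : ∀ y, ∀ z ∈ Set.Icc a b, loss y z ∈ Set.Icc (0 : ℝ) 1)
    {F : ℕ → X → ℝ} {f : X → ℝ} (hF : ∀ k, Measurable (F k)) (hFab : ∀ k x, F k x ∈ Set.Icc a b)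
    (hfab : ∀ x, f x ∈ Set.Icc a b) (hlim : ∀ x, Tendsto (fun k => F k x) atTop (𝓝 (f x)))
    (S : Fin n → X × Y) :
    Tendsto (fun k => |risk P loss (F k) - empRisk loss (F k) S|) atTop
      (𝓝 |risk P loss f - empRisk loss f S|) := by
  have hl : ∀ y x, Tendsto (fun k => loss y (F k x)) atTop (𝓝 (loss y (f x))) := fun y x =>
    ((hlip y).continuousOn _ (hfab x)).tendsto.comp
      (tendsto_nhdsWithin_iff.2 ⟨hlim x, Eventually.of_forall fun k => hFab k x⟩)
  refine (Tendsto.sub ?_ ?_).abs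
  · refine tendsto_integral_of_dominated_convergence (fun _ => 1)
      (fun k => (hmeas.comp (measurable_snd.prodMk
        ((hF k).comp measurable_fst))).aestronglyMeasurable) (integrable_const _)
      (fun k => ae_of_all _ fun p => ?_) (ae_of_all _ fun p => hl _ _)
    have := hbdd p.2 _ (hFab k p.1)
    exact abs_le.2 ⟨by linarith [this.1], this.2⟩
  · exact (tendsto_finsetSum _ fun i _ => hl _ _).div_const _

/-- Concentration for given learners. -/
theorem measure_deviation_fibEnsemble_le {X Y : Type*} [MeasurableSpace X] [MeasurableSpace Y]
    (P : Measure (X × Y)) [IsProbabilityMeasure P] {n : ℕ} (hn : 0 < n) {M : ℕ} (hM : 0 < M)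
    {a b : ℝ} (loss : Y → ℝ → ℝ) (hmeas : Measurable (Function.uncurry loss))
    (hlip : ∀ y, LipschitzOnWith 1 (loss y) (Set.Icc a b))
    (hbdd : ∀ y, ∀ z ∈ Set.Icc a b, loss y z ∈ Set.Icc (0 : ℝ) 1)
    (h : Fin M → X → ℝ) (hh : ∀ m, Measurable (h m))
    (hab : ∀ m, ∀ᵐ p ∂P, h m p.1 ∈ Set.Icc a b) {δ : ℝ} (hδ : 0 < δ) :
    sampleLaw P n {S | √(Real.log (2 / δ) / (2 * (n : ℝ)))
      < |risk P loss (fibEnsemble h) - empRisk loss (fibEnsemble h) S|} ≤ ENNReal.ofReal δ := by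
  have hae : ∀ᵐ p ∂P, fibEnsemble h p.1 ∈ Set.Icc a b := by
    filter_upwards [ae_all_iff.2 hab] with p hp using fibEnsemble_mem_Icc hM hp
  obtain ⟨p₀, hp₀⟩ := hae.exists
  have hle : a ≤ b := hp₀.1.trans hp₀.2
  -- the ensemble truncated to `[a, b]`
  set f : X → ℝ := fun x => max a (min b (fibEnsemble h x)) with hf
  have hfm : Measurable f :=
    measurable_const.max (measurable_const.min (measurable_fibEnsemble hh))
  have hfe : ∀ {x}, fibEnsemble h x ∈ Set.Icc a b → f x = fibEnsemble h x := fun hx => by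
    simp [hf, hx.1, hx.2]
  have key := measure_abs_risk_sub_empRisk_le P hn (a := a) (b := b) loss hmeas hlip hbdd
    (fun _ : Unit => f) (fun _ => hfm)
    (fun _ x => ⟨le_max_left _ _, max_le hle (min_le_left _ _)⟩) (r := 0)
    (by simp [sum_signs_mul_eq_zero]) hδ
  refine le_trans (measure_mono_ae ?_) key
  -- The learners lie in `[a, b]` only almost surely; truncation changes neither the risk nor, for
  -- almost every sample, the empirical risk.
  have hS : ∀ᵐ S ∂(sampleLaw P n), ∀ i : Fin n, fibEnsemble h (S i).1 ∈ Set.Icc a b :=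
    ae_all_iff.2 fun i =>
      (measurePreserving_eval (fun _ : Fin n => P) i).quasiMeasurePreserving.ae hae
  filter_upwards [hS] with S hS hd
  refine ⟨(), ?_⟩
  have e1 : risk P loss f = risk P loss (fibEnsemble h) := by
    refine integral_congr_ae ?_
    filter_upwards [hae] with p hp
    rw [hfe hp]
  have e2 : empRisk loss f S = empRisk loss (fibEnsemble h) S := by
    unfold empRisk
    simp only [hfe (hS _)]
  rw [e1, e2, mul_zero, zero_add]
  exact hd

/-- Uniform concentration over the class of Fibonacci ensembles. -/
theorem measure_deviation_fibClass_le {X Y : Type*} [MeasurableSpace X] [MeasurableSpace Y]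
    (P : Measure (X × Y)) [IsProbabilityMeasure P] {n : ℕ} (hn : 0 < n) {M : ℕ} (hM : 0 < M)
    {a b : ℝ} (loss : Y → ℝ → ℝ) (hmeas : Measurable (Function.uncurry loss))
    (hlip : ∀ y, LipschitzOnWith 1 (loss y) (Set.Icc a b))
    (hbdd : ∀ y, ∀ z ∈ Set.Icc a b, loss y z ∈ Set.Icc (0 : ℝ) 1)
    (H : Fin M → Set (X → ℝ)) (hH : ∀ m, PointwiseMeasurableClass (H m))
    (hab : ∀ m, ∀ f ∈ H m, ∀ x, f x ∈ Set.Icc a b)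
    (hanti : Antitone (fun m => rademacher P n (H m))) {δ : ℝ} (hδ : 0 < δ) :
    sampleLaw P n {S | ∃ f ∈ fibClass H, 2 * rademacher P n (H ⟨0, hM⟩)
        + √(Real.log (2 / δ) / (2 * (n : ℝ))) < |risk P loss f - empRisk loss f S|}
      ≤ ENNReal.ofReal δ := by
  rcases (fibClass H).eq_empty_or_nonempty with he | ⟨_, h₀, hh₀, -⟩
  · simp [he]
  choose hm C hCH hC hap using hH
  have hne : ∀ m, Nonempty (C m) := fun m =>
    let ⟨g, hg, _⟩ := hap m (h₀ m) (hh₀ m)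
    ⟨⟨g 0, hg 0⟩⟩
  have hcount : ∀ m, Countable (C m) := fun m => hC m
  have hr : ∫ S, (∑ ε : Fin n → ℤˣ, ⨆ k : ∀ m, C m, (∑ i, ((ε i : ℤ) : ℝ)
      * fibEnsemble (fun m => (k m : X → ℝ)) (S i).1) / (n : ℝ)) / 2 ^ n ∂(sampleLaw P n)
      ≤ rademacher P n (H ⟨0, hM⟩) := by
    have hint : ∀ m, Integrable (fun S => empRademacher (H m) fun i => (S i).1) (sampleLaw P n) :=
      fun m => integrable_empRademacher P n ⟨hm m, C m, hCH m, hC m, hap m⟩ ⟨h₀ m, hh₀ m⟩ (hab m)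
    calc _ ≤ ∫ S, ∑ m, fibWeight M m * empRademacher (H m) (fun i => (S i).1) ∂(sampleLaw P n) := by
          refine integral_mono ?_ (integrable_finsetSum _ fun m _ => (hint m).const_mul _) fun S =>
            signAverage_fibEnsemble_le hab (fun (k : ∀ m, C m) m => (k m : X → ℝ))
              (fun k m => hCH m (k m).2) _
          refine (integrable_finsetSum _ fun ε _ => ?_).div_const _
          refine integrable_ciSup_of_abs_le (B := max |a| |b|) (fun k => ?_) fun k S =>
            abs_signSum_div_le (fun x => fibEnsemble_mem_Icc hM fun m =>
              hab m _ (hCH m (k m).2) x) ε _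
          have := measurable_fibEnsemble fun m => hm m _ (hCH m (k m).2)
          fun_prop
      _ = ∑ m, fibWeight M m * rademacher P n (H m) := by
          rw [integral_finsetSum _ fun m _ => (hint m).const_mul _]
          simp only [integral_const_mul, rademacher]
      _ ≤ ∑ m, fibWeight M m * rademacher P n (H ⟨0, hM⟩) :=
          Finset.sum_le_sum fun m _ => mul_le_mul_of_nonneg_left
            (hanti (Fin.mk_le_of_le_val (Nat.zero_le _))) (fibWeight_nonneg M m)
      _ = _ := by rw [← Finset.sum_mul, sum_fibWeight hM, one_mul]
  refine le_trans (measure_mono ?_) (measure_abs_risk_sub_empRisk_le P hn loss hmeas hlip hbdd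
    (fun (k : ∀ m, C m) => fibEnsemble (fun m => (k m : X → ℝ)))
    (fun k => measurable_fibEnsemble fun m => hm m _ (hCH m (k m).2))
    (fun k x => fibEnsemble_mem_Icc hM fun m => hab m _ (hCH m (k m).2) x) hr hδ)
  rintro S ⟨_, ⟨h, hh, rfl⟩, hd⟩
  choose g hg hlim using fun m => hap m (h m) (hh m)
  have := tendsto_abs_risk_sub_empRisk P hmeas hlip hbdd
    (F := fun j => fibEnsemble fun m => g m j) (f := fibEnsemble h)
    (fun j => measurable_fibEnsemble fun m => hm m _ (hCH m (hg m j)))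
    (fun j x => fibEnsemble_mem_Icc hM fun m => hab m _ (hCH m (hg m j)) x)
    (fun x => fibEnsemble_mem_Icc hM fun m => hab m _ (hh m) x)
    (fun x => tendsto_finsetSum _ fun m _ => (hlim m x).const_mul _) S
  -- A strict violation is an open condition, so some approximant from the countable product of the
  -- `C m` violates the bound too.
  obtain ⟨j, hj⟩ := (this.eventually (lt_mem_nhds hd)).exists
  exact ⟨fun m => ⟨g m j, hg m j⟩, hj⟩

theorem mainTheorem6 {X Y : Type*} [MeasurableSpace X] [MeasurableSpace Y]
    (P : Measure (X × Y)) [IsProbabilityMeasure P]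
    (n : ℕ) (hn : 0 < n) (M : ℕ) (hM : 0 < M)
    (K : ℝ) (hK : IsFibDecayConstant K)
    (a b : ℝ) (loss : Y → ℝ → ℝ) (hmeas : Measurable (Function.uncurry loss))
    (hlip : ∀ y, LipschitzOnWith 1 (loss y) (Set.Icc a b))
    (hbdd : ∀ y, ∀ z ∈ Set.Icc a b, loss y z ∈ Set.Icc (0 : ℝ) 1) :
    -- given learners, with the empirical Rademacher complexity on the sample itself
    (∀ h : Fin M → X → ℝ, (∀ m, Measurable (h m)) →
      (∀ m, ∀ᵐ p ∂P, h m p.1 ∈ Set.Icc a b) →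
      ∀ δ : ℝ, 0 < δ →
        sampleLaw P n {S | |risk P loss (fibEnsemble h) - empRisk loss (fibEnsemble h) S| ≤
          2 * Real.goldenRatio * K * empRademacher {h ⟨0, hM⟩} (fun i => (S i).1) +
            √(Real.log (2 / δ) / (2 * (n : ℝ)))}ᶜ ≤ ENNReal.ofReal δ) ∧
    -- learners selected from classes by means of the sample, with the Rademacher complexity
    (∀ H : Fin M → Set (X → ℝ), (∀ m, PointwiseMeasurableClass (H m)) →
      (∀ m, ∀ f ∈ H m, ∀ x, f x ∈ Set.Icc a b) →
      Antitone (fun m => rademacher P n (H m)) →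
      ∀ δ : ℝ, 0 < δ →
        sampleLaw P n {S | ∀ f ∈ fibClass H, |risk P loss f - empRisk loss f S| ≤
          2 * Real.goldenRatio * K * rademacher P n (H ⟨0, hM⟩) +
            √(Real.log (2 / δ) / (2 * (n : ℝ)))}ᶜ ≤ ENNReal.ofReal δ) := by
  have hφK : 1 ≤ Real.goldenRatio * K := by
    nlinarith [Real.one_lt_goldenRatio, hK.one_le]
  refine ⟨fun h hh hab δ hδ => ?_, fun H hH hab hanti δ hδ => ?_⟩
  · refine le_trans (measure_mono ?_) (measure_deviation_fibEnsemble_le P hn hM loss hmeas hlip hbdd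
      h hh hab hδ)
    intro S hS
    have := mul_nonneg (zero_le_one.trans hφK)
      (empRademacher_nonneg {h ⟨0, hM⟩} fun i => (S i).1)
    rw [Set.mem_compl_iff, Set.mem_ofPred_eq, not_le] at hS
    rw [Set.mem_ofPred_eq]
    linarith
  · refine le_trans (measure_mono ?_) (measure_deviation_fibClass_le P hn hM loss hmeas hlip hbdd
      H hH hab hanti hδ)
    intro S hS
    have := mul_le_mul_of_nonneg_right hφK (rademacher_nonneg P n (H ⟨0, hM⟩))
    rw [Set.mem_compl_iff, Set.mem_ofPred_eq] at hS
    push Not at hS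
    obtain ⟨f, hf, hd⟩ := hS
    exact ⟨f, hf, by linarith⟩
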